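/- Let $K$ be a number field with ring of integers $O_K$, with $r_1$ real and $r_2$ complex places, and let $F=\mathbb{R}^{r_1}\times\mathbb{C}^{r_2}$, in which $K$ is embedded in the usual way. For $v\in F$ put $|v|_\infty=\prod_{w\text{ real}}|v_w|\prod_{w\text{ complex}}|v_w|^2$. For a nonzero ideal $q$ of $O_K$ let $|q|=\#(O_K/q)$ and let $\omega(q)$ be the number of distinct prime ideals dividing $q$. Let $n,k\ge 0$ be integers and let $Y$ be a closed subscheme of $\mathbb{A}^n_{O_K}$ of codimension $k$. There is a constant $C>0$, depending only on $Y$ (and thus on $K,n,k$), such that for every compact set $B\subset F^n$ and every $\kappa>0$ there is a constant $A>0$, depending only on $Y,B,\kappa$, with the following property. Let $r=(r_1,\dots,r_n)\in F^n$ with $|r_i|_\infty\ge\kappa$ for all $i$, regarded as a diagonal matrix, let $m\in GL_n(F)$ be lower triangular unipotent, and let $q\subseteq O_K$ be a squarefree ideal. Then $$\#\{a\in mrB\cap O_K^n : a \bmod q\in Y(O_K/q)\}\le A\cdot\frac{\prod_{i=1}^n|r_i|_\infty}{|q|^k}\cdot C^{\omega(q)}\cdot\max_{\substack{J\subseteq\{1,\dots,n\}\\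 |J|\le k}}\frac{|q|^{|J|}}{\prod_{i\in J}|r_i|_\infty};$$ in particular the set on the left is finite. (The maximum is $\max\{1,\ |q|/|r_i|_\infty,\ |q|^2/|r_ir_j|_\infty,\dots,\ |q|^k/\prod_{s=1}^k|r_{i_s}|_\infty\}$ over distinct indices.) The same holds over $\mathbb{Z}$: if $Y\subseteq\mathbb{A}^n_{\mathbb{Z}}$ is a closed subscheme of codimension $k$, there is $C>0$ depending only on $Y$ such that for every compact $B\subset\mathbb{R}^n$ and $\kappa>0$ there is $A>0$ depending only on $Y,B,\kappa$ with $$\#\{a\in mrB\cap\mathbb{Z}^n : a\bmod q\in Y(\mathbb{Z}/q\mathbb{Z})\}\le A\cdot\frac{\prod_{i=1}^n r_i}{q^k}\cdot C^{\omega(q)}\cdot\max_{\substack{J\subseteq\{1,\dots,n\}\\ |J|\le k}}\frac{q^{|J|}}{\prod_{i\in J}r_i}$$ for all real $r_1,\dots,r_n\ge\kappa$, all lower triangular unipotent $m\in GL_n(\mathbb{R})$ and all squarefree positive integers $q$, where $\omega(q)$ is the number of primes dividing $q$. -/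

import Mathlib

open NumberField

noncomputable section

/-- The closed subscheme of affine `n`-space over `R` cut out by the ideal `Y` of
`R[x₁, …, xₙ]`, i.e. `Spec (R[x₁, …, xₙ] / Y)`; every closed subscheme of affine space is of
this form for a unique ideal. -/
abbrev ClosedSubschemeOfAffineSpace (R : Type*) [CommRing R] (n : ℕ) : Type _ :=
  Ideal (MvPolynomial (Fin n) R)

namespace ClosedSubschemeOfAffineSpace

variable {R : Type*} [CommRing R] {n : ℕ}

/-- The codimension of the closed subscheme in affine space: the infimum of the codimensions of
its irreducible components, that is, of the heights of the minimal primes over its ideal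
(the empty subscheme has codimension `⊤`). -/
def codim (Y : ClosedSubschemeOfAffineSpace R n) : ℕ∞ :=
  Ideal.height Y

/-- The set `Y(S)` of `S`-points, as a subset of `Sⁿ`, for an `R`-algebra `S`. -/
def points (Y : ClosedSubschemeOfAffineSpace R n) (S : Type*) [CommRing S] [Algebra R S] :
    Set (Fin n → S) :=
  {x | ∀ f : MvPolynomial (Fin n) R, f ∈ Y → MvPolynomial.aeval x f = 0}

end ClosedSubschemeOfAffineSpace

/-- Lower triangular unipotent matrices. -/
def IsLowerUnipotent {F : Type*} [CommRing F] {n : ℕ} (m : Matrix (Fin n) (Fin n) F) : Prop :=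
  (∀ i, m i i = 1) ∧ ∀ i j, i < j → m i j = 0

/-- The region `m r B`, where `r` acts as the diagonal matrix with entries `r₁, …, rₙ`. -/
def skewedBox {F : Type*} [CommRing F] {n : ℕ} (m : Matrix (Fin n) (Fin n) F) (r : Fin n → F)
    (B : Set (Fin n → F)) : Set (Fin n → F) :=
  (fun b => (m * Matrix.diagonal r).mulVec b) '' B

/-- The maximum of `Q ^ |J| / ∏_{i ∈ J} ρᵢ` over the sets `J` of at most `k` indices (the empty
set contributes the entry `1`). -/
def maxTerm {n : ℕ} (k : ℕ) (Q : ℝ) (ρ : Fin n → ℝ) : ℝ :=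
  ((Finset.univ : Finset (Finset (Fin n))).filter (fun J => J.card ≤ k)).sup'
    ⟨∅, by simp⟩ (fun J => Q ^ J.card / ∏ i ∈ J, ρ i)

/-- The number of distinct prime ideals dividing the ideal `q`. -/
def idealOmega {R : Type*} [CommRing R] (q : Ideal R) : ℕ :=
  Set.ncard {p : Ideal R | Prime p ∧ p ∣ q}

/-- The points `a ∈ O_Kⁿ` that lie in the region `E` of `Fⁿ`, `F = ℝ^{r₁} × ℂ^{r₂}`, and whose
reduction modulo `q` is in `Y(O_K / q)`. -/
def integralPoints (K : Type*) [Field K] [NumberField K] {n : ℕ}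
    (Y : ClosedSubschemeOfAffineSpace (𝓞 K) n) (q : Ideal (𝓞 K))
    (E : Set (Fin n → mixedEmbedding.mixedSpace K)) : Set (Fin n → 𝓞 K) :=
  {a | (fun i => mixedEmbedding K (a i : K)) ∈ E ∧
    (fun i => Ideal.Quotient.mk q (a i)) ∈ Y.points (𝓞 K ⧸ q)}

/-- The points `a ∈ ℤⁿ` that lie in the region `E` of `ℝⁿ` and whose reduction modulo `q` is in
`Y(ℤ/qℤ)`. -/
def integerPoints {n : ℕ} (Y : ClosedSubschemeOfAffineSpace ℤ n) (q : ℕ)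
    (E : Set (Fin n → ℝ)) : Set (Fin n → ℤ) :=
  {a | (fun i => (a i : ℝ)) ∈ E ∧ (fun i => (a i : ZMod q)) ∈ Y.points (ZMod q)}

end

/-! Modulo a prime `p` avoiding a fixed nonzero `d`, every point of `Y` solves one of finitely many
triangular systems: for `k` of the indices `i`, the coordinate `x i` is a root of a nonzero
polynomial of bounded degree whose coefficients involve only the `x j` with `j < i`
(`MvPolynomial.exists_triangular_cover`). This rests on the fact that adjoining a variable raises
the height of a prime by at most one (`Polynomial.height_le_height_comap_C_add_one`).

Choosing a system for each good prime divisor of `q` splits the points into at most `#T ^ ω(q)`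
pieces, `T` being the set of systems. On a piece let `Q i` be the product of the norms of the primes
that constrain `x i`; then `∏ Q i` is `|q| ^ k`, up to the primes containing `d`. The order of the
variables agrees with the triangular shape of `m`: once the preceding coordinates are fixed, `x i`
runs through a translate of `r i` times a bounded set, and lies in at most `D ^ ω(q)` classes modulo
an ideal of norm `Q i`. Distinct congruent elements differ by an element of norm at least `Q i`, so
each class contributes `O(1 + |r i| / Q i)` values (`exists_bound_ncard_of_residues`). These counts
multiply over `i` (`Set.ncard_le_prod_of_prefix_fibers`), and expanding `∏ (1 + |r i| / Q i)`
produces the maximum (`prod_one_add_div_le`). The two cases of the theorem are instances of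
`exists_bound_ncard_points`. -/

/-! ### Heights of primes in a polynomial ring in one variable. -/

/-- Inverting the nonzero constants preserves the height of `P` and leads to `F[X]`, of dimension
one. -/
theorem Polynomial.height_le_one_of_disjoint_C {D : Type*} [CommRing D] [IsDomain D]
    (P : Ideal (Polynomial D)) [P.IsPrime] (h : P.comap Polynomial.C = ⊥) : P.height ≤ 1 := by
  let F := FractionRing D
  let M := (nonZeroDivisors D).map (Polynomial.C : D →+* Polynomial D)
  let : Algebra (Polynomial D) (Polynomial F) := Polynomial.algebra D F
  have : IsLocalization M (Polynomial F) := Polynomial.isLocalization (nonZeroDivisors D) F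
  have hd : Disjoint (M : Set (Polynomial D)) (P : Set (Polynomial D)) := by
    refine Set.disjoint_left.mpr ?_
    rintro _ ⟨b, hb, rfl⟩ hP
    have : b ∈ P.comap Polynomial.C := hP
    rw [h, Ideal.mem_bot] at this
    exact nonZeroDivisors.ne_zero hb this
  rw [← IsLocalization.height_map_of_disjoint (S := Polynomial F) M P hd]
  have hp : (P.map (algebraMap (Polynomial D) (Polynomial F))).IsPrime :=
    IsLocalization.isPrime_of_isPrime_disjoint M _ P ‹_› hd
  have h1 := Ideal.height_le_ringKrullDim_of_ne_top hp.ne_top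
  have h2 : ringKrullDim (Polynomial F) ≤ 1 := by
    rw [Polynomial.ringKrullDim_of_isNoetherianRing]
    simp
  exact_mod_cast h1.trans h2

/-- The excess over the height of `p` is at most the height of the image of `P` in `A[X] / pA[X] ≅
(A/p)[X]`, and that image contracts to zero in `A/p`. -/
theorem Polynomial.height_le_height_comap_C_add_one {A : Type*} [CommRing A] [IsNoetherianRing A]
    (P : Ideal (Polynomial A)) [P.IsPrime] :
    P.height ≤ (P.comap Polynomial.C).height + 1 := by
  set p := P.comap Polynomial.C with hp
  have : P.LiesOver p := ⟨rfl⟩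
  have : p.IsPrime := Ideal.comap_isPrime _ _
  refine (Ideal.height_le_height_add_of_liesOver p P).trans ?_
  gcongr
  have hle : p.map Polynomial.C ≤ P := Ideal.map_comap_le
  have hker : RingHom.ker (Ideal.Quotient.mk (p.map (algebraMap A (Polynomial A)))) ≤ P := by
    rw [Ideal.mk_ker]; exact hle
  have : (P.map (Ideal.Quotient.mk (p.map (algebraMap A (Polynomial A))))).IsPrime :=
    Ideal.map_isPrime_of_surjective Ideal.Quotient.mk_surjective hker
  let e : (Polynomial A ⧸ (p.map (algebraMap A (Polynomial A)))) ≃+* Polynomial (A ⧸ p) :=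
    (Ideal.polynomialQuotientEquivQuotientPolynomial p).symm
  rw [← e.height_map]
  have : ((P.map (Ideal.Quotient.mk (p.map (algebraMap A (Polynomial A))))).map e).IsPrime :=
    Ideal.map_isPrime_of_equiv e
  apply Polynomial.height_le_one_of_disjoint_C
  rw [eq_bot_iff]
  intro x hx
  obtain ⟨a, rfl⟩ := Ideal.Quotient.mk_surjective x
  have he : Polynomial.C (Ideal.Quotient.mk p a) =
      e (Ideal.Quotient.mk (p.map (algebraMap A (Polynomial A))) (Polynomial.C a)) := by
    simp only [e]
    erw [Ideal.polynomialQuotientEquivQuotientPolynomial_symm_mk]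
    simp
  rw [Ideal.mem_comap, he] at hx
  have h2 := (Ideal.mem_map_of_equiv e _).mp hx
  obtain ⟨y, hy, hye⟩ := h2
  rw [e.injective hye] at hy
  have h3 := (Ideal.mem_map_iff_of_surjective _ Ideal.Quotient.mk_surjective).mp hy
  obtain ⟨z, hz, hzz⟩ := h3
  rw [Ideal.Quotient.eq] at hzz
  have h4 : Polynomial.C a ∈ P := by
    have := P.sub_mem hz (hle hzz)
    simpa using this
  rw [Ideal.mem_bot, Ideal.Quotient.eq_zero_iff_mem]
  exact h4

theorem Polynomial.height_le_height_comap_C {A : Type*} [CommRing A] [IsNoetherianRing A]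
    (P : Ideal (Polynomial A)) [P.IsPrime] (h : P ≤ (P.comap Polynomial.C).map Polynomial.C) :
    P.height ≤ (P.comap Polynomial.C).height := by
  set p := P.comap Polynomial.C with hp
  have : P.LiesOver p := ⟨rfl⟩
  have : p.IsPrime := Ideal.comap_isPrime _ _
  refine (Ideal.height_le_height_add_of_liesOver p P).trans ?_
  have hbot : P.map (Ideal.Quotient.mk (p.map (algebraMap A (Polynomial A)))) = ⊥ := by
    rw [Ideal.map_eq_bot_iff_le_ker, Ideal.mk_ker]
    exact h
  have : Nontrivial (Polynomial A ⧸ (p.map (algebraMap A (Polynomial A)))) :=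
    Ideal.Quotient.nontrivial_iff.mpr fun ht =>
      Ideal.IsPrime.ne_top ‹P.IsPrime› (top_le_iff.mp (ht ▸ Ideal.map_comap_le))
  rw [hbot, Ideal.height_bot, add_zero]

/-! ### Triangular systems of equations covering a closed subscheme. -/

open MvPolynomial in
/-- For a prime `P` of `R[x₁, …, xₙ]` that meets `R` trivially, at least `P.height` of the
variables satisfy a nontrivial polynomial equation modulo `P` over the preceding ones. -/
theorem MvPolynomial.exists_algebraic_variables {R : Type*} [CommRing R] [IsDomain R]
    [IsNoetherianRing R] : ∀ (n : ℕ) (P : Ideal (MvPolynomial (Fin n) R)), P.IsPrime →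
      P.comap C = ⊥ → ∃ (S : Finset (Fin n)) (f : Fin n → Polynomial (MvPolynomial (Fin n) R)),
        P.height ≤ S.card ∧ ∀ i ∈ S, (∀ l, (f i).coeff l ∈ supported R {j | j < i}) ∧
          (f i).eval (X i) ∈ P ∧ ∃ l, (f i).coeff l ∉ P
  | 0, P, hP, h => by
    refine ⟨∅, fun _ => 0, ?_, by simp⟩
    have : P = ⊥ := by
      rw [eq_bot_iff]
      intro x hx
      obtain ⟨r, rfl⟩ := C_surjective (Fin 0) x
      have : r ∈ P.comap C := hx
      rw [h, Ideal.mem_bot] at this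
      simp [this]
    subst this
    simp [Ideal.height_bot]
  | n + 1, P, hP, h => by
    let ρ : MvPolynomial (Fin n) R →+* MvPolynomial (Fin (n + 1)) R :=
      (rename Fin.castSucc).toRingHom
    have hρ : ∀ x, ρ x = rename Fin.castSucc x := fun _ => rfl
    let P₀ := P.comap ρ
    have hP₀ : P₀.IsPrime := Ideal.comap_isPrime _ _
    let e : MvPolynomial (Fin (n + 1)) R ≃ₐ[R] Polynomial (MvPolynomial (Fin n) R) :=
      (renameEquiv R finSuccEquivLast).trans (optionEquivLeft R (Fin n))
    have heC : ∀ x, e (ρ x) = Polynomial.C x := by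
      intro x
      have : (e.toAlgHom.comp (rename Fin.castSucc)) =
          (Algebra.ofId _ (Polynomial (MvPolynomial (Fin n) R))).restrictScalars R := by
        ext i : 1
        simp [e, optionEquivLeft_X_some, Algebra.ofId_apply]
      exact DFunLike.congr_fun this x
    have heX : e (X (Fin.last n)) = Polynomial.X := by
      simp [e, optionEquivLeft_X_none]
    have heval : ∀ g : Polynomial (MvPolynomial (Fin n) R),
        e ((g.map ρ).eval (X (Fin.last n))) = g := by
      intro g
      rw [Polynomial.eval_map, Polynomial.eval₂_eq_sum_range, map_sum]
      simp only [map_mul, map_pow, heC, heX]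
      exact g.as_sum_range_C_mul_X_pow.symm
    let Q : Ideal (Polynomial (MvPolynomial (Fin n) R)) := P.comap e.symm
    have hQ : Q.IsPrime := Ideal.comap_isPrime _ _
    have hQmem : ∀ g, g ∈ Q ↔ (g.map ρ).eval (X (Fin.last n)) ∈ P := by
      intro g
      conv_lhs => rw [← heval g]
      simp [Q, Ideal.mem_comap]
    have hQP : Q.height = P.height := RingEquiv.height_comap e.symm.toRingEquiv P
    have hQC : Q.comap Polynomial.C = P₀ := by
      ext x
      rw [Ideal.mem_comap, hQmem]
      simp [P₀, Ideal.mem_comap]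
    have h₀ : P₀.comap C = ⊥ := by
      rw [Ideal.comap_comap, ← h]
      congr 1
      ext x
      simp [hρ]
    obtain ⟨S, f, hS, hf⟩ := MvPolynomial.exists_algebraic_variables n P₀ hP₀ h₀
    have key : ∀ i ∈ S, (∀ l, ((f i).map ρ).coeff l ∈ supported R {j | j < i.castSucc}) ∧
          ((f i).map ρ).eval (X i.castSucc) ∈ P ∧ ∃ l, ((f i).map ρ).coeff l ∉ P := by
      intro i hi
      obtain ⟨h1, h2, l, h3⟩ := hf i hi
      refine ⟨fun l => ?_, ?_, l, ?_⟩
      · rw [Polynomial.coeff_map, hρ, mem_supported]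
        refine (Finset.coe_subset.mpr (vars_rename _ _)).trans ?_
        have := mem_supported.mp (h1 l)
        intro j hj
        simp only [Finset.coe_image, Set.mem_image] at hj
        obtain ⟨j, hj, rfl⟩ := hj
        exact Fin.castSucc_lt_castSucc_iff.mpr (this hj)
      · have : X i.castSucc = ρ (X i) := by simp [hρ]
        rw [this, Polynomial.eval_map, Polynomial.eval₂_at_apply]
        exact h2
      · rw [Polynomial.coeff_map]
        exact h3
    -- Either `Q` is extended from its contraction, so the last variable adds no height and is left
    -- free, or some `g ∈ Q` has a coefficient outside `P₀` and serves as the equation for the last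
    -- variable, which pays for the one unit of height gained.
    by_cases hc : Q ≤ (Q.comap Polynomial.C).map Polynomial.C
    · refine ⟨S.map Fin.castSuccEmb, Fin.lastCases 0 (fun i => (f i).map ρ), ?_, ?_⟩
      · rw [← hQP, Finset.card_map]
        exact (Polynomial.height_le_height_comap_C Q hc).trans (hQC ▸ hS)
      · intro i hi
        obtain ⟨i, hiS, rfl⟩ := Finset.mem_map.mp hi
        simpa using key i hiS
    · obtain ⟨g, hg, hg'⟩ := Set.not_subset.mp hc
      refine ⟨(S.map Fin.castSuccEmb).cons (Fin.last n) ?_,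
        Fin.lastCases (g.map ρ) (fun i => (f i).map ρ), ?_, ?_⟩
      · simp
      · rw [← hQP, Finset.card_cons, Finset.card_map]
        refine (Polynomial.height_le_height_comap_C_add_one Q).trans ?_
        rw [hQC]
        push_cast
        gcongr
      · intro i hi
        rcases Finset.mem_cons.mp hi with rfl | hi
        · refine ⟨fun l => ?_, ?_, ?_⟩
          · simp only [Fin.lastCases_last]
            rw [Polynomial.coeff_map, hρ, mem_supported]
            refine (Finset.coe_subset.mpr (vars_rename _ _)).trans ?_
            intro j hj
            simp only [Finset.coe_image, Set.mem_image] at hj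
            obtain ⟨j, hj, rfl⟩ := hj
            exact Fin.castSucc_lt_last j
          · simp only [Fin.lastCases_last]
            exact (hQmem g).mp hg
          · rw [hQC, SetLike.mem_coe, Ideal.mem_map_C_iff] at hg'
            push Not at hg'
            obtain ⟨l, hl⟩ := hg'
            refine ⟨l, ?_⟩
            simp only [Fin.lastCases_last, Polynomial.coeff_map]
            exact hl
        · obtain ⟨i, hiS, rfl⟩ := Finset.mem_map.mp hi
          simpa using key i hiS

open Classical MvPolynomial in
/-- The points of a closed subscheme of codimension at least `k` are covered by finitely many
systems of equations, each of which restricts `k` of the coordinates in terms of the preceding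
ones. -/
theorem MvPolynomial.exists_triangular_cover {R : Type*} [CommRing R] [IsDomain R]
    [IsNoetherianRing R] {n k : ℕ} (I : Ideal (MvPolynomial (Fin n) R)) (hI : (k : ℕ∞) ≤ I.height) :
    ∃ (T : Finset (Finset (Fin n) × (Fin n → Polynomial (MvPolynomial (Fin n) R)))) (d : R),
      d ≠ 0 ∧
      (∀ t ∈ T, t.1.card = k ∧ ∀ i ∈ t.1, ∀ l, (t.2 i).coeff l ∈ supported R {j | j < i}) ∧
      ∀ (L : Type*) [CommRing L] [IsDomain L] (φ : R →+* L) (x : Fin n → L), φ d ≠ 0 →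
        (∀ f ∈ I, eval₂Hom φ x f = 0) →
        ∃ t ∈ T, ∀ i ∈ t.1, (t.2 i).map (eval₂Hom φ x) ≠ 0 ∧
          ((t.2 i).map (eval₂Hom φ x)).eval (x i) = 0 := by
  induction I using IsNoetherian.induction with
  | hgt I IH =>
  have hsup : ∀ (a : MvPolynomial (Fin n) R), a ∉ I → I < I ⊔ Ideal.span {a} := fun a ha =>
    lt_of_le_of_ne le_sup_left fun h =>
      ha (h ▸ Ideal.mem_sup_right (Ideal.mem_span_singleton_self a))
  have hsup' : ∀ (a : MvPolynomial (Fin n) R) (L : Type _) [CommRing L] [IsDomain L] (φ : R →+* L)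
      (x : Fin n → L), (∀ f ∈ I, eval₂Hom φ x f = 0) → eval₂Hom φ x a = 0 →
      ∀ f ∈ I ⊔ Ideal.span {a}, eval₂Hom φ x f = 0 := by
    intro a L _ _ φ x h1 h2 f hf
    have : I ⊔ Ideal.span {a} ≤ RingHom.ker (eval₂Hom φ x) := by
      refine sup_le h1 ?_
      rw [Ideal.span_singleton_le_iff_mem]
      exact h2
    exact this hf
  by_cases htop : I = ⊤
  · refine ⟨∅, 1, one_ne_zero, by simp, ?_⟩
    intro L _ _ φ x _ h
    have := h 1 (htop ▸ Submodule.mem_top)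
    simp at this
  by_cases hp : Ideal.IsPrime I
  · by_cases hC : Ideal.comap C I = ⊥
    · obtain ⟨S', f, hS', hf⟩ := MvPolynomial.exists_algebraic_variables n I hp hC
      obtain ⟨S, hSS', hS⟩ := Finset.exists_subset_card_eq (s := S') (n := k)
        (by exact_mod_cast hI.trans hS')
      have : ∀ i : Fin n, ∃ l, i ∈ S → (f i).coeff l ∉ I := by
        intro i
        by_cases hi : i ∈ S
        · obtain ⟨l, hl⟩ := (hf i (hSS' hi)).2.2
          exact ⟨l, fun _ => hl⟩
        · exact ⟨0, fun h => absurd h hi⟩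
      choose l hl using this
      have := fun (i : S) => IH (I ⊔ Ideal.span {(f i).coeff (l i)}) (hsup _ (hl i i.2))
        (hI.trans (Ideal.height_mono le_sup_left))
      choose T d hd hT hcov using this
      -- The system `(S, f)` serves the points where all the chosen coefficients are nonzero; a
      -- point where one of them vanishes lies on a strictly larger ideal, covered by induction.
      refine ⟨insert (S, f) (Finset.univ.biUnion T), ∏ i, d i,
        Finset.prod_ne_zero_iff.mpr fun i _ => hd i, ?_, ?_⟩
      · intro t ht
        rcases Finset.mem_insert.mp ht with rfl | ht
        · exact ⟨hS, fun i hi => (hf i (hSS' hi)).1⟩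
        · obtain ⟨i, -, hi⟩ := Finset.mem_biUnion.mp ht
          exact hT i t hi
      · intro L _ _ φ x hφ hx
        by_cases h : ∃ i ∈ S, eval₂Hom φ x ((f i).coeff (l i)) = 0
        · obtain ⟨i, hi, h0⟩ := h
          have hφi : φ (d ⟨i, hi⟩) ≠ 0 := fun h => hφ (by
            rw [map_prod]
            exact Finset.prod_eq_zero (Finset.mem_univ ⟨i, hi⟩) h)
          obtain ⟨t, ht, h⟩ := hcov ⟨i, hi⟩ L φ x hφi (hsup' _ L φ x hx h0)
          exact ⟨t, Finset.mem_insert_of_mem 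
            (Finset.mem_biUnion.mpr ⟨⟨i, hi⟩, Finset.mem_univ _, ht⟩),
            h⟩
        · push Not at h
          refine ⟨(S, f), Finset.mem_insert_self _ _, fun i hi => ⟨fun h0 => h i hi ?_, ?_⟩⟩
          · rw [← Polynomial.coeff_map, h0, Polynomial.coeff_zero]
          · have : x i = eval₂Hom φ x (X i) := by simp
            rw [Polynomial.eval_map, this, Polynomial.eval₂_at_apply]
            exact hx _ (hf i (hSS' hi)).2.1
    -- A nonzero constant in `I` excludes every point with `φ d ≠ 0`, so no system is needed.
    · obtain ⟨d, hdI, hd⟩ := Submodule.exists_mem_ne_zero_of_ne_bot hC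
      refine ⟨∅, d, hd, by simp, ?_⟩
      intro L _ _ φ x hφ h
      have := h (C d) hdI
      exact absurd (by simpa using this) hφ
  · obtain ⟨a, ha, b, hb, hab⟩ : ∃ a, a ∉ I ∧ ∃ b, b ∉ I ∧ a * b ∈ I := by
      by_contra! h
      refine hp ⟨htop, fun {a b} hab => ?_⟩
      by_contra! hn
      exact h a hn.1 b hn.2 hab
    obtain ⟨T₁, d₁, hd₁, hT₁, h₁⟩ := IH _ (hsup a ha) (hI.trans (Ideal.height_mono le_sup_left))
    obtain ⟨T₂, d₂, hd₂, hT₂, h₂⟩ := IH _ (hsup b hb) (hI.trans (Ideal.height_mono le_sup_left))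
    refine ⟨T₁ ∪ T₂, d₁ * d₂, mul_ne_zero hd₁ hd₂, ?_, ?_⟩
    · intro t ht
      rcases Finset.mem_union.mp ht with ht | ht
      exacts [hT₁ t ht, hT₂ t ht]
    · intro L _ _ φ x hφ hx
      rw [map_mul] at hφ
      have := hx _ hab
      rw [map_mul] at this
      rcases mul_eq_zero.mp this with h0 | h0
      · obtain ⟨t, ht, h⟩ := h₁ L φ x (left_ne_zero_of_mul hφ) (hsup' _ L φ x hx h0)
        exact ⟨t, Finset.mem_union_left _ ht, h⟩
      · obtain ⟨t, ht, h⟩ := h₂ L φ x (right_ne_zero_of_mul hφ) (hsup' _ L φ x hx h0)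
        exact ⟨t, Finset.mem_union_right _ ht, h⟩

/-! ### Pigeonhole bounds: one coordinate, then vectors. -/

/-- A ball in a finite-dimensional real vector space `F` can be coloured with `O(1 / δ)` colours
in such a way that points `b`, `b'` of the same colour satisfy `‖b - b'‖ ^ dim F < δ`. -/
theorem exists_coloring_ball (F : Type*) [NormedAddCommGroup F] [NormedSpace ℝ F]
    [FiniteDimensional ℝ F] [Nontrivial F] (M : ℝ) :
    ∃ A : ℝ, 0 < A ∧ ∀ δ : ℝ, 0 < δ → δ ≤ 1 →
      ∃ (c : F → Fin (Module.finrank ℝ F) → ℤ) (s : Finset (Fin (Module.finrank ℝ F) → ℤ)),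
        (s.card : ℝ) ≤ A / δ ∧ (∀ b, ‖b‖ ≤ M → c b ∈ s) ∧
        ∀ b b', c b = c b' → ‖b - b'‖ ^ Module.finrank ℝ F < δ := by
  set d := Module.finrank ℝ F with hd
  have hd0 : d ≠ 0 := Module.finrank_pos.ne'
  let e : F ≃L[ℝ] (Fin d → ℝ) := ContinuousLinearEquiv.ofFinrankEq (by simp [hd])
  set K₁ := ‖(e : F →L[ℝ] (Fin d → ℝ))‖
  -- The added 1 makes the final norm estimate strict and keeps the mesh `ε = η / K₂` at most 1.
  set K₂ := ‖(e.symm : (Fin d → ℝ) →L[ℝ] F)‖ + 1 with hK₂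
  have hK₂1 : 1 ≤ K₂ := by simp [hK₂]
  have hK₂0 : 0 < K₂ := by linarith
  set M₁ := K₁ * |M| with hM₁
  have hM₁0 : 0 ≤ M₁ := by positivity
  refine ⟨((2 * M₁ + 3) * K₂) ^ d, by positivity, fun δ hδ hδ1 => ?_⟩
  set η := δ ^ (1 / (d : ℝ)) with hη
  have hη0 : 0 < η := Real.rpow_pos_of_pos hδ _
  have hη1 : η ≤ 1 := Real.rpow_le_one hδ.le hδ1 (by positivity)
  have hηd : η ^ d = δ := by
    rw [hη, one_div, Real.rpow_inv_natCast_pow hδ.le hd0]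
  set ε := η / K₂ with hε
  have hε0 : 0 < ε := by positivity
  have hε1 : ε ≤ 1 := (div_le_one hK₂0).mpr (hη1.trans hK₂1)
  set L : ℤ := ⌈M₁ / ε⌉ with hL
  have hL0 : 0 ≤ L := Int.ceil_nonneg (by positivity)
  refine ⟨fun b i => ⌊e b i / ε⌋, Fintype.piFinset fun _ => Finset.Icc (-L) L, ?_, ?_, ?_⟩
  · rw [Fintype.card_piFinset, Finset.prod_const, Int.card_Icc, Finset.card_univ, Fintype.card_fin]
    have h1 : (((L + 1 - -L).toNat : ℕ) : ℝ) = 2 * L + 1 := by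
      rw [← Int.cast_natCast, Int.toNat_of_nonneg (by linarith)]
      push_cast; ring
    push_cast
    rw [h1, ← hηd, ← div_pow]
    have hLlt : (L : ℝ) < M₁ / ε + 1 := Int.ceil_lt_add_one _
    have h2 : 2 * (L : ℝ) + 1 ≤ (2 * M₁ + 3) * K₂ / η := by
      have : (2 * M₁ + 3) * K₂ / η = 2 * (M₁ / ε) + 3 / ε := by
        rw [hε]; field_simp
      have h3 : 3 ≤ 3 / ε := by rw [le_div_iff₀ hε0]; linarith
      linarith
    have : (0 : ℝ) ≤ L := by exact_mod_cast hL0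
    gcongr
  · intro b hb
    rw [Fintype.mem_piFinset]
    intro i
    have h1 : |e b i| ≤ M₁ := by
      calc |e b i| ≤ ‖e b‖ := norm_le_pi_norm (e b) i
        _ ≤ K₁ * ‖b‖ := (e : F →L[ℝ] (Fin d → ℝ)).le_opNorm b
        _ ≤ K₁ * |M| := by gcongr; exact hb.trans (le_abs_self M)
    have h2 : |e b i / ε| ≤ M₁ / ε := by
      rw [abs_div, abs_of_pos hε0]; gcongr
    rw [Finset.mem_Icc]
    have hLe : M₁ / ε ≤ L := Int.le_ceil _
    constructor
    · rw [Int.le_floor]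
      push_cast
      linarith [(abs_le.mp h2).1]
    · have := Int.floor_le (e b i / ε)
      have h4 : ((⌊e b i / ε⌋ : ℤ) : ℝ) ≤ L := by linarith [(abs_le.mp h2).2]
      exact_mod_cast h4
  · intro b b' hbb
    have h1 : ‖e (b - b')‖ ≤ ε := by
      rw [pi_norm_le_iff_of_nonneg hε0.le]
      intro i
      have h2 := Int.abs_sub_lt_one_of_floor_eq_floor (congrFun hbb i)
      rw [← sub_div, abs_div, abs_of_pos hε0, div_lt_one hε0] at h2
      rw [map_sub]
      exact h2.le
    have h3 : ‖b - b'‖ < η := by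
      calc ‖b - b'‖ = ‖e.symm (e (b - b'))‖ := by rw [e.symm_apply_apply]
        _ ≤ (K₂ - 1) * ‖e (b - b')‖ := by
          rw [hK₂, add_sub_cancel_right]
          exact (e.symm : (Fin d → ℝ) →L[ℝ] F).le_opNorm _
        _ ≤ (K₂ - 1) * ε := by gcongr
        _ < K₂ * ε := by gcongr; linarith
        _ = η := by rw [hε]; field_simp
    calc ‖b - b'‖ ^ d < η ^ d := by gcongr
      _ = δ := hηd

theorem Ideal.prod_absNorm_le_absNorm_span {R : Type*} [CommRing R] [IsDedekindDomain R]
    [Module.Free ℤ R] [Module.Finite ℤ R] (P : Finset (Ideal R)) (hP : ∀ p ∈ P, Prime p) {a : R}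
    (ha : a ≠ 0) (h : ∀ p ∈ P, a ∈ p) :
    ∏ p ∈ P, (Ideal.absNorm p : ℝ) ≤ Ideal.absNorm (Ideal.span {a}) := by
  have hdvd : (∏ p ∈ P, p) ∣ Ideal.span {a} :=
    Finset.prod_primes_dvd _ hP fun p hp => Ideal.dvd_span_singleton.mpr (h p hp)
  have hdvd' := map_dvd Ideal.absNorm hdvd
  have hne : Ideal.absNorm (Ideal.span {a}) ≠ 0 :=
    mt Ideal.absNorm_eq_zero_iff.mp (mt Ideal.span_singleton_eq_bot.mp ha)
  rw [map_prod] at hdvd'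
  exact_mod_cast Nat.le_of_dvd (Nat.pos_of_ne_zero hne) hdvd'

/-- A set whose elements differ by multiples `r * (b - b')`, with `b`, `b'` in a ball of
radius `M`, and which modulo each prime ideal of a finite set `P` lies in a set of at
most `D` residue classes, has at most `A * (1 + N r / ∏ |p|) * D ^ #P` elements. -/
theorem exists_bound_ncard_of_residues {R : Type*} [CommRing R] [IsDedekindDomain R]
    [Module.Free ℤ R] [Module.Finite ℤ R] {F : Type*} [NormedCommRing F] [NormedAlgebra ℝ F]
    [FiniteDimensional ℝ F] [Nontrivial F] (ι : R →+* F) (N : F →*₀ ℝ) (hN0 : ∀ x, 0 ≤ N x)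
    (hN : ∀ x, N x ≤ ‖x‖ ^ Module.finrank ℝ F)
    (hι : ∀ a, N (ι a) = Ideal.absNorm (Ideal.span {a})) (M : ℝ) :
    ∃ A : ℝ, 0 < A ∧ ∀ (r : F) (V : Set R) (b : R → F) (P : Finset (Ideal R))
      (Z : ∀ p : Ideal R, Finset (R ⧸ p)) (D : ℕ),
      (∀ v ∈ V, ‖b v‖ ≤ M) → (∀ v ∈ V, ∀ v' ∈ V, ι (v - v') = r * (b v - b v')) →
      (∀ p ∈ P, Prime p) → (∀ p ∈ P, (Z p).card ≤ D) →
      (∀ p ∈ P, ∀ v ∈ V, Ideal.Quotient.mk p v ∈ Z p) →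
      V.Finite ∧ (V.ncard : ℝ) ≤
        A * (1 + N r / ∏ p ∈ P, (Ideal.absNorm p : ℝ)) * (D : ℝ) ^ P.card := by
  classical
  obtain ⟨A, hA, hcol⟩ := exists_coloring_ball F M
  refine ⟨A, hA, fun r V b P Z D hb hV hP hZ hVZ => ?_⟩
  set Q : ℝ := ∏ p ∈ P, (Ideal.absNorm p : ℝ) with hQ
  have hQ0 : 0 < Q := Finset.prod_pos fun p hp => by
    exact_mod_cast Nat.pos_of_ne_zero (mt Ideal.absNorm_eq_zero_iff.mp (hP p hp).ne_zero)
  have hr := hN0 r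
  -- This `δ` is at most 1 and satisfies `N r * δ < Q`, so two elements of equal colour and equal
  -- residues coincide; moreover `1 / δ = 1 + N r / Q`.
  obtain ⟨c, s, hs, hcs, hc⟩ := hcol (Q / (Q + N r)) (by positivity)
    ((div_le_one (by positivity)).mpr (by linarith))
  let Φ : R → (Fin (Module.finrank ℝ F) → ℤ) × (∀ p : P, R ⧸ (p : Ideal R)) :=
    fun v => (c (b v), fun p => Ideal.Quotient.mk _ v)
  let W : Finset ((Fin (Module.finrank ℝ F) → ℤ) × (∀ p : P, R ⧸ (p : Ideal R))) :=
    s ×ˢ Fintype.piFinset fun p : P => Z p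
  have hmaps : Set.MapsTo Φ V (W : Set _) := by
    intro v hv
    simp only [W, Φ, Finset.coe_product, Set.mem_prod, Finset.mem_coe, Fintype.mem_piFinset]
    exact ⟨hcs _ (hb v hv), fun p => hVZ p p.2 v hv⟩
  have hinj : Set.InjOn Φ V := by
    intro v hv v' hv' hvv
    simp only [Φ, Prod.mk.injEq] at hvv
    obtain ⟨h1, h2⟩ := hvv
    by_contra hne
    have hle : Q ≤ N (ι (v - v')) := by
      rw [hι]
      refine Ideal.prod_absNorm_le_absNorm_span P hP (sub_ne_zero.mpr hne) fun p hp => ?_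
      exact Ideal.Quotient.eq.mp (congrFun h2 ⟨p, hp⟩)
    have hlt : N (b v - b v') < Q / (Q + N r) := (hN _).trans_lt (hc _ _ h1)
    rw [hV v hv v' hv', map_mul] at hle
    have h5 : N r * N (b v - b v') ≤ N r * (Q / (Q + N r)) := by gcongr
    have h6 : N r * (Q / (Q + N r)) < Q := by
      rw [← mul_div_assoc, div_lt_iff₀ (by positivity)]
      nlinarith
    linarith
  refine ⟨Set.Finite.of_injOn hmaps hinj W.finite_toSet, ?_⟩
  have h1 : V.ncard ≤ W.card := by
    rw [← Set.ncard_coe_finset]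
    exact Set.ncard_le_ncard_of_injOn Φ hmaps hinj W.finite_toSet
  have h2 : W.card ≤ s.card * D ^ P.card := by
    rw [Finset.card_product, Fintype.card_piFinset]
    gcongr
    calc ∏ p : P, (Z p).card ≤ ∏ p : P, D := Finset.prod_le_prod' fun p _ => hZ p p.2
      _ = D ^ P.card := by simp
  calc (V.ncard : ℝ) ≤ ((s.card * D ^ P.card : ℕ) : ℝ) := by exact_mod_cast h1.trans h2
    _ = s.card * (D : ℝ) ^ P.card := by push_cast; rfl
    _ ≤ A / (Q / (Q + N r)) * (D : ℝ) ^ P.card := by gcongr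
    _ = _ := by field_simp

theorem Set.Finite.exists_injOn_lt {α : Type*} {T : Set α} (hT : T.Finite) {d : ℕ}
    (hd : T.ncard ≤ d) : ∃ e : α → ℕ, Set.InjOn e T ∧ ∀ a ∈ T, e a < d := by
  classical
  have := hT.to_subtype
  let f := Finite.equivFin T
  refine ⟨fun a => if h : a ∈ T then f ⟨a, h⟩ else 0, ?_, ?_⟩
  · intro a ha b hb hab
    simp only [ha, hb, dif_pos] at hab
    exact congrArg Subtype.val (f.injective (Fin.ext hab))
  · intro a ha
    simp only [ha, dif_pos]
    exact (f ⟨a, ha⟩).2.trans_le ((Nat.card_coe_set_eq T).trans_le hd)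

/-- A set of vectors in which, for every `i`, each choice of the entries before the `i`-th
leaves at most `D i` values for the `i`-th has at most `∏ D i` elements. -/
theorem Set.ncard_le_prod_of_prefix_fibers {α : Type*} {n : ℕ} (E : Set (Fin n → α)) (D : Fin n → ℝ)
    (hD : ∀ i, 0 ≤ D i)
    (h : ∀ x ∈ E, ∀ i, {a | ∃ y ∈ E, (∀ j < i, y j = x j) ∧ y i = a}.Finite ∧
      ({a | ∃ y ∈ E, (∀ j < i, y j = x j) ∧ y i = a}.ncard : ℝ) ≤ D i) :
    E.Finite ∧ (E.ncard : ℝ) ≤ ∏ i, D i := by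
  classical
  let T : (Fin n → α) → Fin n → Set α := fun x i => {a | ∃ y ∈ E, (∀ j < i, y j = x j) ∧ y i = a}
  have hT : ∀ (t : Set α) (i : Fin n), ∃ e : α → ℕ, t.Finite → (t.ncard : ℝ) ≤ D i →
      Set.InjOn e t ∧ ∀ a ∈ t, e a < ⌊D i⌋₊ := by
    intro t i
    by_cases ht : t.Finite ∧ (t.ncard : ℝ) ≤ D i
    · obtain ⟨e, he⟩ := ht.1.exists_injOn_lt (Nat.le_floor ht.2)
      exact ⟨e, fun _ _ => he⟩
    · exact ⟨fun _ => 0, fun h1 h2 => absurd ⟨h1, h2⟩ ht⟩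
  choose e he using hT
  have hself : ∀ x ∈ E, ∀ i, x i ∈ T x i := fun x hx i => ⟨x, hx, fun _ _ => rfl, rfl⟩
  -- Each entry is labelled within the set of values allowed by its prefix. Equal prefixes give the
  -- same set, so the labels recover the vector entry by entry.
  let Φ : (Fin n → α) → Fin n → ℕ := fun x i => e (T x i) i (x i)
  let W : Finset (Fin n → ℕ) := Fintype.piFinset fun i => Finset.range ⌊D i⌋₊
  have hmaps : Set.MapsTo Φ E (W : Set _) := by
    intro x hx
    simp only [W, Φ, Finset.mem_coe, Fintype.mem_piFinset, Finset.mem_range]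
    exact fun i => (he _ i (h x hx i).1 (h x hx i).2).2 _ (hself x hx i)
  have hinj : Set.InjOn Φ E := by
    intro x hx y hy hxy
    funext i
    induction i using WellFoundedLT.induction with
    | ind i IH =>
    have hTT : T y i = T x i := by
      ext a
      refine ⟨?_, ?_⟩
      · rintro ⟨w, hw, h1, h2⟩
        exact ⟨w, hw, fun j hj => (h1 j hj).trans (IH j hj).symm, h2⟩
      · rintro ⟨w, hw, h1, h2⟩
        exact ⟨w, hw, fun j hj => (h1 j hj).trans (IH j hj), h2⟩
    have h1 : e (T x i) i (x i) = e (T y i) i (y i) := congrFun hxy i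
    rw [hTT] at h1
    exact (he _ i (h x hx i).1 (h x hx i).2).1 (hself x hx i)
      (show y i ∈ T x i from hTT ▸ hself y hy i) h1
  refine ⟨Set.Finite.of_injOn hmaps hinj W.finite_toSet, ?_⟩
  have h1 : E.ncard ≤ W.card := by
    rw [← Set.ncard_coe_finset]
    exact Set.ncard_le_ncard_of_injOn Φ hmaps hinj W.finite_toSet
  rw [Fintype.card_piFinset] at h1
  calc (E.ncard : ℝ) ≤ ((∏ i, (Finset.range ⌊D i⌋₊).card : ℕ) : ℝ) := by exact_mod_cast h1
    _ = ∏ i, (⌊D i⌋₊ : ℝ) := by simp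
    _ ≤ ∏ i, D i := Finset.prod_le_prod (fun _ _ => Nat.cast_nonneg _)
        fun i _ => Nat.floor_le (hD i)

/-! ### Unipotent matrices and the maximum over index sets. -/

theorem IsLowerUnipotent.mulVec_apply_eq_self {F : Type*} [CommRing F] {n : ℕ}
    {m : Matrix (Fin n) (Fin n) F} (hm : IsLowerUnipotent m) {w : Fin n → F} {i : Fin n}
    (hw : ∀ j < i, w j = 0) : m.mulVec w i = w i := by
  rw [Matrix.mulVec, dotProduct, Finset.sum_eq_single i]
  · rw [hm.1, one_mul]
  · intro j _ hji
    rcases lt_or_gt_of_ne hji with h | h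
    · rw [hw j h, mul_zero]
    · rw [hm.2 i j h, zero_mul]
  · simp

/-- This is why the bound does not depend on `m`: agreement of the earlier entries of the images
forces agreement of the earlier entries of `z` and `z'`, so `m` does not distort the `i`-th
difference. -/
theorem IsLowerUnipotent.mulVec_sub_apply {F : Type*} [CommRing F] {n : ℕ}
    {m : Matrix (Fin n) (Fin n) F} (hm : IsLowerUnipotent m) {z z' : Fin n → F} {i : Fin n}
    (h : ∀ j < i, m.mulVec z j = m.mulVec z' j) :
    m.mulVec z i - m.mulVec z' i = z i - z' i := by
  have hw : ∀ j < i, (z - z') j = 0 := by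
    intro j
    induction j using WellFoundedLT.induction with
    | ind j IH =>
    intro hj
    rw [← hm.mulVec_apply_eq_self fun l hl => IH l hl (hl.trans hj), Matrix.mulVec_sub,
      Pi.sub_apply, h j hj, sub_self]
  rw [← Pi.sub_apply, ← Matrix.mulVec_sub, hm.mulVec_apply_eq_self hw, Pi.sub_apply]

theorem le_maxTerm {n : ℕ} {k : ℕ} (Q : ℝ) (ρ : Fin n → ℝ) {J : Finset (Fin n)} (hJ : J.card ≤ k) :
    Q ^ J.card / ∏ i ∈ J, ρ i ≤ maxTerm k Q ρ := by
  rw [maxTerm]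
  exact Finset.le_sup' (fun J : Finset (Fin n) => Q ^ J.card / ∏ i ∈ J, ρ i) (by simpa using hJ)

theorem one_le_maxTerm {n : ℕ} (k : ℕ) (Q : ℝ) (ρ : Fin n → ℝ) : 1 ≤ maxTerm k Q ρ := by
  simpa using le_maxTerm (k := k) Q ρ (J := ∅) (by simp)

theorem maxTerm_mono {n : ℕ} (k : ℕ) {Q Q' : ℝ} (hQ : 0 ≤ Q) (hQQ : Q ≤ Q') {ρ : Fin n → ℝ}
    (hρ : ∀ i, 0 < ρ i) : maxTerm k Q ρ ≤ maxTerm k Q' ρ := by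
  refine Finset.sup'_le _ _ fun J hJ => ?_
  refine le_trans ?_ (le_maxTerm Q' ρ (by simpa using hJ))
  have : 0 < ∏ i ∈ J, ρ i := Finset.prod_pos fun i _ => hρ i
  gcongr

/-- After `∏ (ρ i / Q i)` is factored out, `∏ (1 + Q i / ρ i)` is a sum over the `2 ^ n` index sets
`J`, each term being at most `L ^ n` times the maximum. -/
theorem prod_one_add_div_le {n : ℕ} (k : ℕ) {ρ Q : Fin n → ℝ} {q κ : ℝ} (hκ : 0 < κ)
    (hρ : ∀ i, κ ≤ ρ i) (hQ1 : ∀ i, 1 ≤ Q i) (hQq : ∀ i, Q i ≤ q) (hq : 1 ≤ q)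
    (hQ : ∏ i, Q i = q ^ k) :
    ∏ i, (1 + ρ i / Q i) ≤
      (2 * max 1 κ⁻¹) ^ n * ((∏ i, ρ i) / q ^ k) * maxTerm k q ρ := by
  classical
  set L := max 1 κ⁻¹ with hL
  have hL1 : 1 ≤ L := le_max_left _ _
  have hρ0 : ∀ i, 0 < ρ i := fun i => hκ.trans_le (hρ i)
  have hQ0 : ∀ i, 0 < Q i := fun i => one_pos.trans_le (hQ1 i)
  have hM := one_le_maxTerm k q ρ
  have hterm : ∀ J : Finset (Fin n), ∏ i ∈ J, (Q i / ρ i) ≤ L ^ n * maxTerm k q ρ := by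
    intro J
    rw [Finset.prod_div_distrib]
    have hJ0 : ∀ J : Finset (Fin n), 0 < ∏ i ∈ J, ρ i := fun J => Finset.prod_pos fun i _ => hρ0 i
    by_cases hJ : J.card ≤ k
    · calc (∏ i ∈ J, Q i) / ∏ i ∈ J, ρ i ≤ q ^ J.card / ∏ i ∈ J, ρ i := by
            gcongr
            · exact (hJ0 J).le
            · rw [← Finset.prod_const]
              exact Finset.prod_le_prod (fun i _ => (hQ0 i).le) fun i _ => hQq i
        _ ≤ 1 * maxTerm k q ρ := by rw [one_mul]; exact le_maxTerm q ρ hJ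
        _ ≤ L ^ n * maxTerm k q ρ := by gcongr; exact one_le_pow₀ hL1
    -- For a set with more than `k` indices, all the `Q i` together still give at most `q ^ k`; a
    -- subset of size `k` absorbs this, and each remaining `1 / ρ i` is at most `κ⁻¹`.
    · obtain ⟨J', hJ', hcard⟩ := Finset.exists_subset_card_eq (le_of_not_ge hJ)
      have h1 : ∏ i ∈ J, Q i ≤ q ^ J'.card := by
        rw [hcard, ← hQ]
        exact Finset.prod_le_prod_of_subset_of_one_le (Finset.subset_univ J)
          (fun i _ => (hQ0 i).le) fun i _ _ => hQ1 i
      have h2 : (∏ i ∈ J \ J', ρ i)⁻¹ ≤ L ^ n := by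
        rw [← Finset.prod_inv_distrib]
        calc ∏ i ∈ J \ J', (ρ i)⁻¹ ≤ ∏ i ∈ J \ J', L := by
              refine Finset.prod_le_prod (fun i _ => (inv_pos.mpr (hρ0 i)).le) fun i _ => ?_
              exact (inv_anti₀ hκ (hρ i)).trans (le_max_right _ _)
          _ = L ^ (J \ J').card := by simp
          _ ≤ L ^ n := pow_le_pow_right₀ hL1 (by simpa using Finset.card_le_univ (J \ J'))
      calc (∏ i ∈ J, Q i) / ∏ i ∈ J, ρ i
          = (∏ i ∈ J \ J', ρ i)⁻¹ * ((∏ i ∈ J, Q i) / ∏ i ∈ J', ρ i) := by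
            rw [← Finset.prod_sdiff (f := ρ) hJ']
            have := (hJ0 J').ne'
            have := (hJ0 (J \ J')).ne'
            field_simp
        _ ≤ L ^ n * (q ^ J'.card / ∏ i ∈ J', ρ i) := by
            have := hJ0 J'
            gcongr
            exact div_nonneg (Finset.prod_nonneg fun i _ => (hQ0 i).le) this.le
        _ ≤ L ^ n * maxTerm k q ρ := by
            gcongr
            exact le_maxTerm q ρ hcard.le
  calc ∏ i, (1 + ρ i / Q i) = (∏ i, (ρ i / Q i)) * ∏ i, (1 + Q i / ρ i) := by
        rw [← Finset.prod_mul_distrib]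
        refine Finset.prod_congr rfl fun i _ => ?_
        have := (hρ0 i).ne'
        have := (hQ0 i).ne'
        field_simp
        ring
    _ = ((∏ i, ρ i) / q ^ k) * ∑ J : Finset (Fin n), ∏ i ∈ J, (Q i / ρ i) := by
        rw [Finset.prod_div_distrib, hQ, Finset.prod_one_add, Finset.powerset_univ]
    _ ≤ ((∏ i, ρ i) / q ^ k) * ∑ J : Finset (Fin n), L ^ n * maxTerm k q ρ := by
        have : 0 ≤ ∏ i, ρ i := Finset.prod_nonneg fun i _ => (hρ0 i).le
        gcongr with J
        exact hterm J
    _ = _ := by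
        simp [mul_pow]
        ring

/-! ### Counting the solutions of a triangular system. -/

theorem MvPolynomial.map_eval₂Hom_eq_of_supported {R L : Type*} [CommRing R] [CommRing L] {n : ℕ}
    (φ : R →+* L) {x y : Fin n → L} {i : Fin n} (hxy : ∀ j < i, y j = x j)
    {f : Polynomial (MvPolynomial (Fin n) R)}
    (hf : ∀ l, f.coeff l ∈ MvPolynomial.supported R {j | j < i}) :
    f.map (MvPolynomial.eval₂Hom φ y) = f.map (MvPolynomial.eval₂Hom φ x) := by
  ext l
  rw [Polynomial.coeff_map, Polynomial.coeff_map]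
  refine MvPolynomial.eval₂Hom_congr' rfl (fun j hj _ => hxy j ?_) rfl
  exact MvPolynomial.mem_supported.mp (hf l) hj

/-- Lattice points of a skewed box that, modulo each prime ideal of a finite set `P`, solve a given
triangular system of equations. -/
theorem exists_bound_ncard_of_triangular {R : Type*} [CommRing R] [IsDedekindDomain R]
    [Module.Free ℤ R] [Module.Finite ℤ R] {F : Type*} [NormedCommRing F] [NormedAlgebra ℝ F]
    [FiniteDimensional ℝ F] [Nontrivial F] (ι : R →+* F) (N : F →*₀ ℝ) (hN0 : ∀ x, 0 ≤ N x)
    (hN : ∀ x, N x ≤ ‖x‖ ^ Module.finrank ℝ F)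
    (hι : ∀ a, N (ι a) = Ideal.absNorm (Ideal.span {a})) {n : ℕ} {B : Set (Fin n → F)}
    (hB : IsCompact B) :
    ∃ A : ℝ, 0 < A ∧ ∀ (r : Fin n → F) (m : Matrix (Fin n) (Fin n) F) (P : Finset (Ideal R))
      (σ : Ideal R → Finset (Fin n) × (Fin n → Polynomial (MvPolynomial (Fin n) R))) (D : ℕ)
      (E : Set (Fin n → R)), IsLowerUnipotent m → (∀ p ∈ P, Prime p) →
      (∀ p ∈ P, ∀ i ∈ (σ p).1, ((σ p).2 i).natDegree ≤ D ∧
        ∀ l, ((σ p).2 i).coeff l ∈ MvPolynomial.supported R {j | j < i}) →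
      (∀ a ∈ E, (fun i => ι (a i)) ∈ skewedBox m r B) →
      (∀ a ∈ E, ∀ p ∈ P, ∀ i ∈ (σ p).1,
        ((σ p).2 i).map (MvPolynomial.eval₂Hom (Ideal.Quotient.mk p)
          fun j => Ideal.Quotient.mk p (a j)) ≠ 0 ∧
        (((σ p).2 i).map (MvPolynomial.eval₂Hom (Ideal.Quotient.mk p)
          fun j => Ideal.Quotient.mk p (a j))).eval (Ideal.Quotient.mk p (a i)) = 0) →
      E.Finite ∧ (E.ncard : ℝ) ≤ ∏ i, (A * (1 + N (r i) /
        ∏ p ∈ P with i ∈ (σ p).1, (Ideal.absNorm p : ℝ)) *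
          (D : ℝ) ^ (P.filter fun p => i ∈ (σ p).1).card) := by
  classical
  obtain ⟨M, hM⟩ := hB.isBounded.exists_norm_le
  obtain ⟨A, hA, hbound⟩ := exists_bound_ncard_of_residues ι N hN0 hN hι M
  refine ⟨A, hA, fun r m P σ D E hm hP hσ hbox hroot => ?_⟩
  refine Set.ncard_le_prod_of_prefix_fibers E _ (fun i => ?_) fun x hx i => ?_
  · have := hN0 (r i)
    positivity
  set V := {a | ∃ y ∈ E, (∀ j < i, y j = x j) ∧ y i = a} with hV
  have hb : ∀ v : R, ∃ b : Fin n → F, v ∈ V → b ∈ B ∧ ∃ y ∈ E, (∀ j < i, y j = x j) ∧ y i = v ∧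
      ∀ j, ι (y j) = m.mulVec (fun l => r l * b l) j := by
    intro v
    by_cases hv : v ∈ V
    · obtain ⟨y, hy, h1, h2⟩ := hv
      obtain ⟨b, hb, h3⟩ := hbox y hy
      refine ⟨b, fun _ => ⟨hb, y, hy, h1, h2, fun j => ?_⟩⟩
      rw [← congrFun h3 j]
      simp only [← Matrix.mulVec_mulVec]
      congr 2
      ext l
      rw [Matrix.mulVec_diagonal]
    · exact ⟨0, fun h => absurd h hv⟩
  choose b hb using hb
  have hZ : ∀ p : Ideal R, ∃ Z : Finset (R ⧸ p), p ∈ P.filter (fun p => i ∈ (σ p).1) →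
      Z.card ≤ D ∧ ∀ v ∈ V, Ideal.Quotient.mk p v ∈ Z := by
    intro p
    by_cases hp : p ∈ P.filter (fun p => i ∈ (σ p).1)
    · obtain ⟨hpP, hpi⟩ := Finset.mem_filter.mp hp
      have hprime : p.IsPrime := Ideal.isPrime_of_prime (hP p hpP)
      set g := ((σ p).2 i).map (MvPolynomial.eval₂Hom (Ideal.Quotient.mk p)
          fun j => Ideal.Quotient.mk p (x j)) with hg
      refine ⟨g.roots.toFinset, fun _ => ⟨?_, ?_⟩⟩
      · exact (Multiset.toFinset_card_le _).trans ((Polynomial.card_roots' g).trans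
          (Polynomial.natDegree_map_le.trans (hσ p hpP i hpi).1))
      · rintro _ ⟨y, hy, h1, rfl⟩
        -- The coefficients see only the coordinates before `i`, so one polynomial `g` serves the
        -- whole fibre over the prefix of `x`.
        have heq : g = ((σ p).2 i).map (MvPolynomial.eval₂Hom (Ideal.Quotient.mk p)
            fun j => Ideal.Quotient.mk p (y j)) :=
          (MvPolynomial.map_eval₂Hom_eq_of_supported _ (fun j hj => by rw [h1 j hj])
            (hσ p hpP i hpi).2).symm
        rw [Multiset.mem_toFinset, Polynomial.mem_roots', Polynomial.IsRoot.def, heq]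
        exact hroot y hy p hpP i hpi
    · exact ⟨∅, fun h => absurd h hp⟩
  choose Z hZ using hZ
  refine hbound (r i) V (fun v => b v i) _ Z D (fun v hv => ?_) (fun v hv v' hv' => ?_)
    (fun p hp => hP p (Finset.mem_filter.mp hp).1) (fun p hp => (hZ p hp).1)
    (fun p hp => (hZ p hp).2)
  · exact (norm_le_pi_norm _ i).trans (hM _ (hb v hv).1)
  · obtain ⟨-, y, -, h1, h2, h3⟩ := hb v hv
    obtain ⟨-, y', -, h1', h2', h3'⟩ := hb v' hv'
    rw [map_sub, ← h2, ← h2', h3, h3', h2, h2', hm.mulVec_sub_apply, mul_sub]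
    intro j hj
    rw [← h3, ← h3', h1 j hj, h1' j hj]

/-! ### Assembling the general bound over the primes dividing `q`. -/

theorem Ideal.exists_finset_primes_of_squarefree {R : Type*} [CommRing R] [IsDedekindDomain R]
    [Module.Free ℤ R] {q : Ideal R} (hq : Squarefree q) :
    ∃ P : Finset (Ideal R), (∀ p, p ∈ P ↔ Prime p ∧ p ∣ q) ∧ idealOmega q = P.card ∧
      ∏ p ∈ P, (Ideal.absNorm p : ℝ) = Ideal.absNorm q := by
  classical
  have hq0 : q ≠ 0 := hq.ne_zero
  have hmemP : ∀ p, p ∈ (UniqueFactorizationMonoid.normalizedFactors q).toFinset ↔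
      Prime p ∧ p ∣ q := fun p => by
    rw [Multiset.mem_toFinset, UniqueFactorizationMonoid.mem_normalizedFactors_iff' hq0]
    simp [UniqueFactorizationMonoid.irreducible_iff_prime]
  refine ⟨_, hmemP, ?_, ?_⟩
  · rw [idealOmega, ← Set.ncard_coe_finset]
    congr 1
    ext p
    simp only [Finset.mem_coe, hmemP, Set.mem_ofPred_eq]
  · have h1 := (UniqueFactorizationMonoid.squarefree_iff_nodup_normalizedFactors hq0).mp hq
    have h2 : ∏ p ∈ (UniqueFactorizationMonoid.normalizedFactors q).toFinset, p = q := by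
      rw [Finset.prod_eq_multiset_prod, Multiset.toFinset_val, Multiset.dedup_eq_self.mpr h1,
        Multiset.map_id', Ideal.prod_normalizedFactors_eq_self hq0]
    conv_rhs => rw [← h2, map_prod, Nat.cast_prod]

theorem prod_mul_pow_le {n : ℕ} {A D : ℝ} (hA : 0 ≤ A) (hD : 1 ≤ D) {x : Fin n → ℝ}
    (hx : ∀ i, 0 ≤ x i) {c : Fin n → ℕ} {s : ℕ} (hc : ∀ i, c i ≤ s) :
    ∏ i, (A * x i * D ^ c i) ≤ A ^ n * D ^ (n * s) * ∏ i, x i := by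
  have hD0 : 0 ≤ D := zero_le_one.trans hD
  calc ∏ i, (A * x i * D ^ c i) ≤ ∏ i, (A * x i * D ^ s) := by
        refine Finset.prod_le_prod (fun i _ => ?_) fun i _ => ?_
        · exact mul_nonneg (mul_nonneg hA (hx i)) (pow_nonneg hD0 _)
        · exact mul_le_mul_of_nonneg_left (pow_le_pow_right₀ hD (hc i)) (mul_nonneg hA (hx i))
    _ = A ^ n * D ^ (n * s) * ∏ i, x i := by
        rw [Finset.prod_mul_distrib, Finset.prod_mul_distrib]
        simp only [Finset.prod_const, Finset.card_univ, Fintype.card_fin]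
        rw [← pow_mul, mul_comm n]
        ring

/-- Bookkeeping for the discarded primes: passing from `Q` back to `q` costs `Δ ^ k`, and everything
exponential in the number `s` of primes collects into `(T * D ^ n) ^ s`. -/
theorem bound_of_factor_bound {n k s : ℕ} {A D T L Δ Q q ρ μ μ' : ℝ} (hA : 0 ≤ A) (hD : 0 ≤ D)
    (hT : 0 ≤ T) (hL : 0 ≤ L) (hΔ : 0 ≤ Δ) (hQ : 0 < Q) (hq : 0 < q) (hqQ : q ≤ Q * Δ)
    (hρ : 0 ≤ ρ) (hμ : 0 ≤ μ) (hμμ : μ ≤ μ') :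
    T ^ s * (A ^ n * D ^ (n * s) * (L ^ n * (ρ / Q ^ k) * μ)) ≤
      A ^ n * L ^ n * Δ ^ k * (ρ / q ^ k) * (T * D ^ n) ^ s * μ' := by
  have hQk : ρ / Q ^ k ≤ Δ ^ k * (ρ / q ^ k) := by
    rw [← mul_div_assoc, div_le_div_iff₀ (by positivity) (by positivity)]
    calc ρ * q ^ k ≤ ρ * (Q * Δ) ^ k := by gcongr
      _ = _ := by ring
  calc T ^ s * (A ^ n * D ^ (n * s) * (L ^ n * (ρ / Q ^ k) * μ))
      ≤ T ^ s * (A ^ n * D ^ (n * s) * (L ^ n * (Δ ^ k * (ρ / q ^ k)) * μ')) := by gcongr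
    _ = _ := by
        rw [mul_pow, pow_mul]
        ring

/-- The bound for the number of points of a closed subscheme of codimension at least `k`, for a
ring `R` that is embedded as a lattice in `F`. -/
theorem exists_bound_ncard_points {R : Type*} [CommRing R] [IsDedekindDomain R]
    [Module.Free ℤ R] [Module.Finite ℤ R] {F : Type*} [NormedCommRing F] [NormedAlgebra ℝ F]
    [FiniteDimensional ℝ F] [Nontrivial F] (ι : R →+* F) (N : F →*₀ ℝ) (hN0 : ∀ x, 0 ≤ N x)
    (hN : ∀ x, N x ≤ ‖x‖ ^ Module.finrank ℝ F)
    (hι : ∀ a, N (ι a) = Ideal.absNorm (Ideal.span {a})) {n k : ℕ}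
    (Y : ClosedSubschemeOfAffineSpace R n) (hY : (k : ℕ∞) ≤ Y.codim) :
    ∃ C : ℝ, 0 < C ∧ ∀ B : Set (Fin n → F), IsCompact B → ∀ κ : ℝ, 0 < κ →
      ∃ A : ℝ, 0 < A ∧ ∀ (r : Fin n → F) (m : Matrix (Fin n) (Fin n) F) (q : Ideal R),
        (∀ i, κ ≤ N (r i)) → IsLowerUnipotent m → Squarefree q → ∀ E : Set (Fin n → R),
        (∀ a ∈ E, (fun i => ι (a i)) ∈ skewedBox m r B) →
        (∀ a ∈ E, (fun i => Ideal.Quotient.mk q (a i)) ∈ Y.points (R ⧸ q)) →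
        E.Finite ∧ (E.ncard : ℝ) ≤ A * ((∏ i, N (r i)) / (Ideal.absNorm q : ℝ) ^ k) *
          C ^ idealOmega q * maxTerm k (Ideal.absNorm q : ℝ) fun i => N (r i) := by
  classical
  obtain ⟨T, d, hd, hT, hcov⟩ := MvPolynomial.exists_triangular_cover Y hY
  -- The floor 1, here and in `T₁`, makes powers increase with the exponent, so that counts of
  -- subsets of primes may be replaced by `ω(q)`.
  set D : ℕ := (T.sup fun t => Finset.univ.sup fun i => (t.2 i).natDegree) ⊔ 1 with hD
  have hD1 : 1 ≤ D := le_sup_right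
  have hTD : ∀ t ∈ T, ∀ i, (t.2 i).natDegree ≤ D := fun t ht i =>
    le_trans (Finset.le_sup (f := fun i => (t.2 i).natDegree) (Finset.mem_univ i))
      ((Finset.le_sup (f := fun t => Finset.univ.sup fun i => (t.2 i).natDegree) ht).trans
        le_sup_left)
  set T₁ : ℕ := T.card ⊔ 1 with hT₁
  have hT₁1 : 1 ≤ T₁ := le_sup_right
  have hC1 : (1 : ℝ) ≤ T₁ * (D : ℝ) ^ n := by
    exact_mod_cast Nat.one_le_iff_ne_zero.mpr (by positivity)
  set Δ : ℝ := Nat.cast (Ideal.absNorm (Ideal.span {d})) with hΔ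
  have hΔ0 : 0 < Δ := by
    rw [hΔ]
    exact_mod_cast Nat.pos_of_ne_zero
      (mt Ideal.absNorm_eq_zero_iff.mp (mt Ideal.span_singleton_eq_bot.mp hd))
  clear_value D T₁ Δ
  refine ⟨T₁ * (D : ℝ) ^ n, by positivity, fun B hB κ hκ => ?_⟩
  obtain ⟨A, hA, hbound⟩ := exists_bound_ncard_of_triangular ι N hN0 hN hι hB
  refine ⟨A ^ n * (2 * max 1 κ⁻¹) ^ n * Δ ^ k, by positivity,
    fun r m q hr hm hq E hEbox hEY => ?_⟩
  obtain ⟨P, hmemP, hPω, hPq⟩ := Ideal.exists_finset_primes_of_squarefree hq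
  -- Only these primes are used. The others all divide `(d)`, so their norms multiply to at most
  -- `Δ`.
  set G := P.filter fun p => d ∉ p with hG
  have hGprime : ∀ p ∈ G, Prime p := fun p hp => ((hmemP p).mp (Finset.mem_filter.mp hp).1).1
  have hGcard : G.card ≤ P.card := Finset.card_filter_le _ _
  have hnorm1 : ∀ p ∈ P, (1 : ℝ) ≤ Ideal.absNorm p := fun p hp => by
    exact_mod_cast Nat.one_le_iff_ne_zero.mpr
      (mt Ideal.absNorm_eq_zero_iff.mp ((hmemP p).mp hp).1.ne_zero)
  have hnormG : ∀ p ∈ G, (1 : ℝ) ≤ Ideal.absNorm p := fun p hp =>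
    hnorm1 p (Finset.mem_filter.mp hp).1
  set Q : ℝ := ∏ p ∈ G, (Ideal.absNorm p : ℝ) with hQ
  clear_value Q
  have hQ1 : 1 ≤ Q := hQ ▸ Finset.one_le_prod hnormG
  have hQle : Q ≤ Ideal.absNorm q := by
    rw [← hPq, hQ]
    exact Finset.prod_le_prod_of_subset_of_one_le (Finset.filter_subset _ _)
      (fun p hp => zero_le_one.trans (hnormG p hp)) fun p hp _ => hnorm1 p hp
  have hqQ : (Ideal.absNorm q : ℝ) ≤ Q * Δ := by
    have hbad : ∏ p ∈ P with ¬ d ∉ p, (Ideal.absNorm p : ℝ) ≤ Δ := by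
      rw [hΔ]
      refine Ideal.prod_absNorm_le_absNorm_span _ (fun p hp => ?_) hd fun p hp => ?_
      · exact ((hmemP p).mp (Finset.mem_filter.mp hp).1).1
      · exact not_not.mp (Finset.mem_filter.mp hp).2
    rw [← hPq, ← Finset.prod_filter_mul_prod_filter_not P (fun p => d ∉ p), ← hG, ← hQ]
    exact mul_le_mul_of_nonneg_left hbad (zero_le_one.trans hQ1)
  have hq1 : (1 : ℝ) ≤ Ideal.absNorm q := hQ1.trans hQle
  have hρ0 : ∀ i, 0 < N (r i) := fun i => hκ.trans_le (hr i)
  have hprod0 : 0 < ∏ i, N (r i) := Finset.prod_pos fun i _ => hρ0 i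
  have hmax0 : 0 < maxTerm k Q fun i => N (r i) := one_pos.trans_le (one_le_maxTerm _ _ _)
  let sys : (G → T) → Ideal R → Finset (Fin n) × (Fin n → Polynomial (MvPolynomial (Fin n) R)) :=
    fun τ p => if h : p ∈ G then τ ⟨p, h⟩ else (∅, 0)
  have hsysT : ∀ τ, ∀ p ∈ G, sys τ p ∈ T := fun τ p hp => by
    simp only [sys, hp, dif_pos, Finset.coe_mem]
  let Eτ : (G → T) → Set (Fin n → R) := fun τ => {a ∈ E | ∀ p ∈ G, ∀ i ∈ (sys τ p).1,
        ((sys τ p).2 i).map (MvPolynomial.eval₂Hom (Ideal.Quotient.mk p)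
          fun j => Ideal.Quotient.mk p (a j)) ≠ 0 ∧
        (((sys τ p).2 i).map (MvPolynomial.eval₂Hom (Ideal.Quotient.mk p)
          fun j => Ideal.Quotient.mk p (a j))).eval (Ideal.Quotient.mk p (a i)) = 0}
  have hcover : E ⊆ ⋃ τ, Eτ τ := by
    intro a ha
    have hp : ∀ p : G, ∃ t : T, ∀ i ∈ t.1.1,
        (t.1.2 i).map (MvPolynomial.eval₂Hom (Ideal.Quotient.mk (p : Ideal R))
          fun j => Ideal.Quotient.mk (p : Ideal R) (a j)) ≠ 0 ∧
        ((t.1.2 i).map (MvPolynomial.eval₂Hom (Ideal.Quotient.mk (p : Ideal R))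
          fun j => Ideal.Quotient.mk (p : Ideal R) (a j))).eval
            (Ideal.Quotient.mk (p : Ideal R) (a i)) = 0 := by
      rintro ⟨p, hp⟩
      have hprime : p.IsPrime := Ideal.isPrime_of_prime (hGprime p hp)
      obtain ⟨t, ht, h⟩ := hcov (R ⧸ p) (Ideal.Quotient.mk p) (fun j => Ideal.Quotient.mk p (a j))
        (by
          rw [Ne, Ideal.Quotient.eq_zero_iff_mem]
          exact (Finset.mem_filter.mp hp).2)
        (by
          intro f hf
          have h1 : MvPolynomial.eval₂ (Ideal.Quotient.mk q)
            (fun j => Ideal.Quotient.mk q (a j)) f = 0 := hEY a ha f hf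
          have h2 := MvPolynomial.eval₂_comp (Ideal.Quotient.mk q) a f
          have h3 := MvPolynomial.eval₂_comp (Ideal.Quotient.mk p) a f
          have h4 : MvPolynomial.eval a f ∈ q := by
            rw [← Ideal.Quotient.eq_zero_iff_mem, h2]
            exact h1
          have h5 : q ≤ p := Ideal.dvd_iff_le.mp ((hmemP p).mp (Finset.mem_filter.mp hp).1).2
          rw [MvPolynomial.coe_eval₂Hom]
          exact h3.symm.trans (Ideal.Quotient.eq_zero_iff_mem.mpr (h5 h4)))
      exact ⟨⟨t, ht⟩, h⟩
    choose τ hτ using hp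
    refine Set.mem_iUnion.mpr ⟨τ, ha, fun p hp => ?_⟩
    have : sys τ p = τ ⟨p, hp⟩ := by simp only [sys, hp, dif_pos]
    rw [this]
    exact hτ ⟨p, hp⟩
  set X : ℝ := (A ^ n * (D : ℝ) ^ (n * P.card)) *
    ((2 * max 1 κ⁻¹) ^ n * ((∏ i, N (r i)) / Q ^ k) * maxTerm k Q fun i => N (r i)) with hX
  have hL0 : (0 : ℝ) ≤ 2 * max 1 κ⁻¹ := mul_nonneg zero_le_two (le_max_of_le_left zero_le_one)
  have hX0 : 0 ≤ X := mul_nonneg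
    (mul_nonneg (pow_nonneg hA.le _) (pow_nonneg (Nat.cast_nonneg _) _))
    (mul_nonneg (mul_nonneg (pow_nonneg hL0 _)
      (div_nonneg hprod0.le (pow_nonneg (zero_le_one.trans hQ1) _))) hmax0.le)
  have hpiece : ∀ τ, (Eτ τ).Finite ∧ ((Eτ τ).ncard : ℝ) ≤ X := by
    intro τ
    obtain ⟨hfin, hle⟩ := hbound r m G (sys τ) D (Eτ τ) hm hGprime
      (fun p hp i hi => ⟨hTD _ (hsysT τ p hp) i, (hT _ (hsysT τ p hp)).2 i hi⟩)
      (fun a ha => hEbox a ha.1) (fun a ha => ha.2)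
    refine ⟨hfin, hle.trans ?_⟩
    set Qi : Fin n → ℝ := fun i => ∏ p ∈ G with i ∈ (sys τ p).1, (Ideal.absNorm p : ℝ) with hQi
    have hQi1 : ∀ i, 1 ≤ Qi i := fun i =>
      Finset.one_le_prod fun p hp => hnormG p (Finset.mem_filter.mp hp).1
    have hQiQ : ∀ i, Qi i ≤ Q := fun i => hQ ▸
      Finset.prod_le_prod_of_subset_of_one_le (Finset.filter_subset _ _)
        (fun p hp => zero_le_one.trans (hnormG p (Finset.mem_filter.mp hp).1))
        fun p hp _ => hnormG p hp
    -- Each prime constrains exactly `k` coordinates.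
    have hQik : ∏ i, Qi i = Q ^ k := by
      simp only [hQi, Finset.prod_filter]
      rw [Finset.prod_comm, hQ, ← Finset.prod_pow]
      refine Finset.prod_congr rfl fun p hp => ?_
      rw [Finset.prod_ite_mem, Finset.univ_inter, Finset.prod_const, (hT _ (hsysT τ p hp)).1]
    have hD1' : (1 : ℝ) ≤ D := by exact_mod_cast hD1
    refine (prod_mul_pow_le hA.le hD1' (fun i => ?_)
      fun i => (Finset.card_filter_le _ _).trans hGcard).trans ?_
    · exact add_nonneg zero_le_one (div_nonneg (hN0 _) (zero_le_one.trans (hQi1 i)))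
    · exact mul_le_mul_of_nonneg_left (prod_one_add_div_le k hκ hr hQi1 hQiQ hQ1 hQik)
        (mul_nonneg (pow_nonneg hA.le _) (pow_nonneg (Nat.cast_nonneg _) _))
  have hfin : (⋃ τ, Eτ τ).Finite := Set.finite_iUnion fun τ => (hpiece τ).1
  refine ⟨hfin.subset hcover, ?_⟩
  have hcount : (E.ncard : ℝ) ≤ (T₁ : ℝ) ^ P.card * X := by
    calc (E.ncard : ℝ) ≤ ((∑ τ, (Eτ τ).ncard : ℕ) : ℝ) := by
          exact_mod_cast (Set.ncard_le_ncard hcover hfin).trans (Set.ncard_iUnion_le_of_fintype _)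
      _ = ∑ τ, ((Eτ τ).ncard : ℝ) := by push_cast; rfl
      _ ≤ ∑ τ : G → T, X := Finset.sum_le_sum fun τ _ => (hpiece τ).2
      _ = (T.card : ℝ) ^ G.card * X := by simp
      _ ≤ (T₁ : ℝ) ^ P.card * X := by
          refine mul_le_mul_of_nonneg_right ?_ hX0
          have h1 : (T.card : ℝ) ≤ T₁ := by exact_mod_cast hT₁ ▸ le_sup_left
          have h2 : (1 : ℝ) ≤ T₁ := by exact_mod_cast hT₁1
          exact (pow_le_pow_left₀ (Nat.cast_nonneg _) h1 _).trans (pow_le_pow_right₀ h2 hGcard)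
  rw [hPω]
  exact hcount.trans (bound_of_factor_bound hA.le (Nat.cast_nonneg D) (Nat.cast_nonneg T₁) hL0
    hΔ0.le (one_pos.trans_le hQ1) (one_pos.trans_le hq1) hqQ hprod0.le hmax0.le
    (maxTerm_mono k (zero_le_one.trans hQ1) hQle hρ0))

/-! ### The number field and the integers as instances. -/

-- The norm is a product of absolute values at the places, counted with multiplicity; the
-- multiplicities add up to the real dimension, and each factor is at most the sup norm.
open scoped Classical in
theorem NumberField.mixedEmbedding.norm_le_norm_pow_finrank {K : Type*} [Field K] [NumberField K]
    (x : mixedEmbedding.mixedSpace K) :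
    mixedEmbedding.norm x ≤ ‖x‖ ^ Module.finrank ℝ (mixedEmbedding.mixedSpace K) := by
  rw [mixedEmbedding.finrank, ← InfinitePlace.sum_mult_eq, ← Finset.prod_pow_eq_pow_sum,
    mixedEmbedding.norm_apply]
  refine Finset.prod_le_prod (fun w _ => pow_nonneg (mixedEmbedding.normAtPlace_nonneg w x) _)
    fun w _ => pow_le_pow_left₀ (mixedEmbedding.normAtPlace_nonneg w x) ?_ _
  rw [mixedEmbedding.norm_eq_sup'_normAtPlace]
  exact Finset.le_sup' (fun w => mixedEmbedding.normAtPlace w x) (Finset.mem_univ w)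

theorem NumberField.mixedEmbedding.norm_algebraMap_eq_absNorm {K : Type*} [Field K] [NumberField K]
    (a : 𝓞 K) : mixedEmbedding.norm (((mixedEmbedding K).comp (algebraMap (𝓞 K) K)) a) =
      Ideal.absNorm (Ideal.span {a}) := by
  rw [RingHom.comp_apply, mixedEmbedding.norm_eq_norm, Ideal.absNorm_span_singleton,
    ← Algebra.coe_norm_int, Nat.cast_natAbs]
  push_cast
  rfl

theorem Int.idealOmega_span_natCast {q : ℕ} (hq : q ≠ 0) :
    idealOmega (Ideal.span {(q : ℤ)}) = q.primeFactors.card := by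
  have hinj : Set.InjOn (fun p : ℕ => Ideal.span {(p : ℤ)}) (q.primeFactors : Set ℕ) := by
    intro a _ b _ hab
    have := congrArg Ideal.absNorm hab
    simpa using this
  rw [idealOmega, ← Set.ncard_coe_finset, ← hinj.ncard_image]
  congr 1
  ext p
  simp only [Set.mem_image, Finset.mem_coe, Set.mem_ofPred_eq, Nat.mem_primeFactors_of_ne_zero hq]
  constructor
  · rintro ⟨hp, hpq⟩
    refine ⟨Ideal.absNorm p, ⟨(Int.prime_absNorm p).mpr hp, ?_⟩,
      Int.ideal_span_absNorm_eq_self p⟩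
    simpa using map_dvd Ideal.absNorm hpq
  · rintro ⟨p, ⟨hp, hpq⟩, rfl⟩
    refine ⟨?_, ?_⟩
    · rw [Ideal.prime_span_singleton_iff]
      exact Nat.prime_iff_prime_int.mp hp
    · rw [Ideal.dvd_span_singleton, Ideal.mem_span_singleton]
      exact_mod_cast hpq

/-- Membership over either model of the residue ring says that `q` divides `f(a)` for all `f ∈ Y`.
-/
theorem ClosedSubschemeOfAffineSpace.mem_points_quotient_span {n q : ℕ}
    {Y : ClosedSubschemeOfAffineSpace ℤ n} {a : Fin n → ℤ}
    (h : (fun i => (a i : ZMod q)) ∈ Y.points (ZMod q)) :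
    (fun i => Ideal.Quotient.mk (Ideal.span {(q : ℤ)}) (a i)) ∈
      Y.points (ℤ ⧸ Ideal.span {(q : ℤ)}) := by
  intro f hf
  have h1 : MvPolynomial.eval₂ (algebraMap ℤ (ZMod q)) (fun i => (a i : ZMod q)) f = 0 := h f hf
  have h2 := MvPolynomial.eval₂_comp (algebraMap ℤ (ZMod q)) a f
  have h3 := MvPolynomial.eval₂_comp (Ideal.Quotient.mk (Ideal.span {(q : ℤ)})) a f
  have h4 : ((MvPolynomial.eval a f : ℤ) : ZMod q) = 0 := by
    rw [← eq_intCast (algebraMap ℤ (ZMod q)), h2]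
    exact h1
  refine h3.symm.trans ?_
  rw [Ideal.Quotient.eq_zero_iff_mem, Ideal.mem_span_singleton]
  exact (ZMod.intCast_zmod_eq_zero_iff_dvd _ _).mp h4

theorem mainTheorem9 :
    (∀ (K : Type*) [Field K] [NumberField K] (n k : ℕ)
        (Y : ClosedSubschemeOfAffineSpace (𝓞 K) n), Y.codim = k →
      ∃ C : ℝ, 0 < C ∧
        ∀ B : Set (Fin n → mixedEmbedding.mixedSpace K), IsCompact B → ∀ κ : ℝ, 0 < κ →
          ∃ A : ℝ, 0 < A ∧
            ∀ (r : Fin n → mixedEmbedding.mixedSpace K)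
              (m : Matrix (Fin n) (Fin n) (mixedEmbedding.mixedSpace K)) (q : Ideal (𝓞 K)),
              (∀ i, κ ≤ mixedEmbedding.norm (r i)) → IsLowerUnipotent m → Squarefree q →
                (integralPoints K Y q (skewedBox m r B)).Finite ∧
                ((integralPoints K Y q (skewedBox m r B)).ncard : ℝ) ≤
                  A * ((∏ i, mixedEmbedding.norm (r i)) / (Ideal.absNorm q : ℝ) ^ k) *
                    C ^ idealOmega q *
                    maxTerm k (Ideal.absNorm q : ℝ) (fun i => mixedEmbedding.norm (r i))) ∧
    (∀ (n k : ℕ) (Y : ClosedSubschemeOfAffineSpace ℤ n), Y.codim = k →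
      ∃ C : ℝ, 0 < C ∧
        ∀ B : Set (Fin n → ℝ), IsCompact B → ∀ κ : ℝ, 0 < κ →
          ∃ A : ℝ, 0 < A ∧
            ∀ (r : Fin n → ℝ) (m : Matrix (Fin n) (Fin n) ℝ) (q : ℕ),
              (∀ i, κ ≤ r i) → IsLowerUnipotent m → Squarefree q →
                (integerPoints Y q (skewedBox m r B)).Finite ∧
                ((integerPoints Y q (skewedBox m r B)).ncard : ℝ) ≤
                  A * ((∏ i, r i) / (q : ℝ) ^ k) * C ^ q.primeFactors.card *
                    maxTerm k (q : ℝ) r) := by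
  constructor
  · intro K _ _ n k Y hY
    classical
    obtain ⟨C, hC, h⟩ := exists_bound_ncard_points
      ((mixedEmbedding K).comp (algebraMap (𝓞 K) K)) (mixedEmbedding.norm (K := K))
      mixedEmbedding.norm_nonneg mixedEmbedding.norm_le_norm_pow_finrank
      mixedEmbedding.norm_algebraMap_eq_absNorm Y hY.ge
    refine ⟨C, hC, fun B hB κ hκ => ?_⟩
    obtain ⟨A, hA, h⟩ := h B hB κ hκ
    exact ⟨A, hA, fun r m q hr hm hq => h r m q hr hm hq _ (fun a ha => ha.1) fun a ha => ha.2⟩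
  · intro n k Y hY
    obtain ⟨C, hC, h⟩ := exists_bound_ncard_points (Int.castRingHom ℝ) (normHom (α := ℝ))
      norm_nonneg (fun x => by simp) (fun a => by simp) Y hY.ge
    refine ⟨C, hC, fun B hB κ hκ => ?_⟩
    obtain ⟨A, hA, h⟩ := h B hB κ hκ
    refine ⟨A, hA, fun r m q hr hm hq => ?_⟩
    have hnorm : ∀ i, (normHom (α := ℝ)) (r i) = r i := fun i =>
      Real.norm_of_nonneg (hκ.le.trans (hr i))
    have := h r m (Ideal.span {(q : ℤ)}) (fun i => (hr i).trans (hnorm i).ge) hm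
      (Ideal.squarefree_span_singleton.mpr (Int.squarefree_natCast.mpr hq))
      (integerPoints Y q (skewedBox m r B)) (fun a ha => ha.1)
      fun a ha => ClosedSubschemeOfAffineSpace.mem_points_quotient_span ha.2
    simpa only [hnorm, Int.idealOmega_span_natCast hq.ne_zero, Ideal.absNorm_span_natCast,
      Module.finrank_self, pow_one] using this
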